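/- All graphs are finite and simple. For an $n$-vertex graph $G$, a set $X\subseteq V(G)$ is a balanced separator if each connected component of $G-X$ has at most $2n/3$ vertices; $s(G)$ denotes the minimum size of a balanced separator of $G$. Let $f:(0,\infty)\to[0,\infty)$ and $t:(0,\infty)\to(0,\infty)$ be non-decreasing functions, and let $p:(0,\infty)\to(0,\infty)$ be the inverse of the function $x\mapsto x\,t(x)$, that is, the non-decreasing function satisfying $p(x\,t(x))=x$ for every $x>0$. (If $x\mapsto x\,t(x)$ is a bijection of $(0,\infty)$, this is its usual inverse; if $t$ has jumps, $p$ is the unique non-decreasing extension of the inverse to $(0,\infty)$.) Let $G$ be a graph such that every nonempty induced subgraph $H$ of $G$ satisfies $s(H)\le f(|V(H)|)$. Let $G'$ be a graph obtained from $G$ by subdividing each edge at least $t(|V(G)|)$ times, where different edges may be subdivided different numbers of times. Then every nonempty induced subgraph $H'$ of $G'$ satisfies $$s(H')\le 15\,f\bigl(p(2|V(H')|)\bigr)+1 .$$ -/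

import Mathlib

namespace SimpleGraph

/-- `X` is a balanced separator of the (finite) graph `G`: every connected component of `G - X` has
at most `2 |V(G)| / 3` vertices. -/
def IsBalancedSeparator {V : Type*} (G : SimpleGraph V) (X : Set V) : Prop :=
  ∀ C : (G.induce Xᶜ).ConnectedComponent, (C.supp.ncard : ℝ) ≤ 2 * (Nat.card V : ℝ) / 3

/-- `s(G)`: the minimum size of a balanced separator of the (finite) graph `G`. -/
noncomputable def sepNumber {V : Type*} (G : SimpleGraph V) : ℕ :=
  sInf {m : ℕ | ∃ X : Set V, G.IsBalancedSeparator X ∧ X.ncard = m}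

/-- The whole vertex set is a balanced separator. -/
theorem isBalancedSeparator_univ {V : Type*} (G : SimpleGraph V) :
    G.IsBalancedSeparator Set.univ := by
  intro C
  induction C using ConnectedComponent.ind with
  | h v => exact absurd (Set.mem_univ v.1) v.2

/-- The minimum in the definition of `s(G)` is attained. -/
theorem exists_isBalancedSeparator_ncard_eq {V : Type*} (G : SimpleGraph V) :
    ∃ X : Set V, G.IsBalancedSeparator X ∧ X.ncard = G.sepNumber :=
  Nat.sInf_mem (s := {m : ℕ | ∃ X : Set V, G.IsBalancedSeparator X ∧ X.ncard = m})
    ⟨_, Set.univ, G.isBalancedSeparator_univ, rfl⟩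

/-- The vertices of the graph obtained from `G` by subdividing each edge `e` exactly `k e` times:
the vertices of `G`, and `k e` new vertices for each edge `e`. -/
abbrev SubdivVertex {V : Type*} (G : SimpleGraph V) (k : G.edgeSet → ℕ) : Type _ :=
  V ⊕ (Σ e : G.edgeSet, Fin (k e))

/-- The `i`-th vertex (`0 ≤ i ≤ k e + 1`) of the path replacing the edge `e`: position `0` is one
end of `e`, position `k e + 1` is the other end, and the positions between them are the new
vertices of `e` in order. The direction in which `e` is traversed is chosen arbitrarily. -/
noncomputable def subdivPath {V : Type*} (G : SimpleGraph V) (k : G.edgeSet → ℕ)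
    (e : G.edgeSet) (i : ℕ) : G.SubdivVertex k :=
  if i = 0 then Sum.inl (Quot.out (e : Sym2 V)).1
  else if h : i - 1 < k e then Sum.inr ⟨e, ⟨i - 1, h⟩⟩
  else Sum.inl (Quot.out (e : Sym2 V)).2

theorem subdivPath_ne_succ {V : Type*} (G : SimpleGraph V) (k : G.edgeSet → ℕ)
    (e : G.edgeSet) (i : ℕ) (hi : i ≤ k e) :
    G.subdivPath k e i ≠ G.subdivPath k e (i + 1) := by
  have hne : (Quot.out (e : Sym2 V)).1 ≠ (Quot.out (e : Sym2 V)).2 := by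
    have h : s((Quot.out (e : Sym2 V)).1, (Quot.out (e : Sym2 V)).2) = (e : Sym2 V) :=
      Quot.out_eq (e : Sym2 V)
    have h2 := e.2
    rw [← h, mem_edgeSet] at h2
    exact h2.ne
  unfold subdivPath
  rcases Nat.eq_zero_or_pos i with rfl | hpos
  · by_cases h : 0 < k e <;> simp [h, hne]
  · have h0 : i ≠ 0 := by omega
    have h1 : i - 1 < k e := by omega
    by_cases h : i < k e
    · simp [h0, h1, h]
      omega
    · simp [h0, h1, h]

/-- The graph obtained from `G` by subdividing each edge `e` exactly `k e` times, that is, by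
replacing `e` by a path with `k e` new inner vertices. -/
noncomputable def subdivide {V : Type*} (G : SimpleGraph V) (k : G.edgeSet → ℕ) :
    SimpleGraph (G.SubdivVertex k) where
  Adj x y := ∃ e : G.edgeSet, ∃ i : ℕ, i ≤ k e ∧
    s(x, y) = s(G.subdivPath k e i, G.subdivPath k e (i + 1))
  symm := ⟨fun x y ⟨e, i, hi, h⟩ => ⟨e, i, hi, by rw [Sym2.eq_swap, h]⟩⟩
  loopless := ⟨fun x ⟨e, i, hi, h⟩ => by
    rcases Sym2.eq_iff.1 h with ⟨h1, h2⟩ | ⟨h1, h2⟩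
    · exact G.subdivPath_ne_succ k e i hi (h1.symm.trans h2)
    · exact G.subdivPath_ne_succ k e i hi (h2.symm.trans h1)⟩

end SimpleGraph

/-!
Let `H'` be the subgraph of the subdivision induced by `S'`, with `N` vertices. An edge of `G` is
full if its whole path lies in `H'`. Let `U` be the set of branch vertices that are ends of full
edges, and let `H` be the graph on `U` formed by the full edges. Each full edge accounts for at
least `t(|V(G)|)` new vertices of `H'`, and `|U|` is at most twice the number of full edges. Hence
`|F| t(|F|) ≤ 2N`, that is, `|F| ≤ p(2N)`, for each nonempty `F ⊆ U`
(`card_mul_le_two_mul_ncard`). So every induced subgraph of `H` has a balanced separator of order at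
most `a = ⌊f(p(2N))⌋`.

Suppose that `H'` has no balanced separator of order at most `13 a + 1`. Then, for each set `Y` of
at most `13 a` vertices of `U`, there is a component of `H' - Y` with more than `2N/3` vertices. It
meets `U`, because `H' - U` is a forest and otherwise one more vertex, a centroid, would break the
component up. The traces `β Y` of these components on `U` form a haven of order `13 a` in `H`
(`exists_isHaven`).

Such a haven cannot exist (`IsHaven.false_of_hasBalancedSeparators`), by an argument related to the
theorem of Dvořák and Norin that the treewidth is linear in the separation number. If `a = 0`, the
connected set `β ∅` would need a separator. Let `a > 0`. For a natural number `c`, consider the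
minimum of `c |Y| + |β Y|` over the sets `Y` of order at most `13 a`. There is a `c > 0` for which
the minimum exceeds `6 c a` and is attained at a set `X` of order at most `12 a`. By minimality, `c`
units of flow can be sent to each vertex of `X` from `U \ β X`, where each vertex has supply one and
capacity `c`. An economical flow uses exactly the vertices of a set `A' ⊇ X` with `c |X|` elements
(`exists_subset_card_eq_mul`, from Hall's theorem). Take a balanced separator `S` of `F = β X ∪ A'`,
and let `D` be the component of `F - S` that contains `β (X ∪ S)`. The set `S ∪ (X ∩ D)` separates
`D ∩ β X` from the rest, so `|F| = c |X| + |β X| ≤ c a + c |X ∩ D| + |D ∩ β X|`. All but `c a` units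
of the flow into `X ∩ D` start in `D`, so the right-hand side is at most `2 c a + |D| ≤ 2 c a + 2
|F| / 3`. This gives `|F| ≤ 6 c a`, a contradiction.
-/

namespace SimpleGraph

/-! ### Integral flows with vertex capacities -/

/-- `rboundary r A R` is the set of elements of `A` outside `R` that are `r`-related to an element
of `R`: the neighbourhood of `R` inside `A`. -/
noncomputable def rboundary {V : Type*} (r : V → V → Prop) (A R : Finset V) : Finset V :=
  open Classical in {v ∈ A \ R | ∃ u ∈ R, r u v}

theorem mem_rboundary {V : Type*} {r : V → V → Prop} {A R : Finset V} {v : V} :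
    v ∈ rboundary r A R ↔ v ∈ A ∧ v ∉ R ∧ ∃ u ∈ R, r u v := by
  classical
  simp [rboundary, and_assoc]

/-- The receiver slot `q` (one of the `c` slots of the vertex `q.1`) may be served by `y` if `y` is
a sender slot of `q.1` itself or of an `r`-neighbour of `q.1`, this vertex lying in `A` and outside
the set `X` of sinks, or if `y` is the single unit of supply of `q.1`. -/
def ServedBy {V : Type*} {c : ℕ} (r : V → V → Prop) (A X : Finset V) (q : V × Fin c) :
    (V × Fin c) ⊕ V → Prop
  | .inl s => s.1 ∈ A ∧ s.1 ∉ X ∧ (s.1 = q.1 ∨ r q.1 s.1)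
  | .inr v => v = q.1

/-- An integral flow in `A` that saturates all the sinks `X`: every vertex of `A` has `c` receiver
slots, each served by its own sender slot or unit of supply. A receiver slot served by a sender slot
of the same vertex stands for unused capacity of that vertex. -/
structure IsSlotFlow {V : Type*} {c : ℕ} (r : V → V → Prop) (A X : Finset V)
    (g : V × Fin c → (V × Fin c) ⊕ V) : Prop where
  servedBy : ∀ q, q.1 ∈ A → ServedBy r A X q (g q)
  inj : ∀ q q', q.1 ∈ A → q'.1 ∈ A → g q = g q' → q = q'

/-- The price of serving a receiver slot at `v` by `y`: unused capacity is free, the supply of `v`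
costs `1`, and the slots of other vertices cost `2`. -/
noncomputable def slotCost {V : Type*} {c : ℕ} (v : V) : (V × Fin c) ⊕ V → ℕ
  | .inl s => open Classical in if s.1 = v then 0 else 2
  | .inr _ => 1

/-- The number of vertices of `A` plus the total price of the flow `g`. -/
noncomputable def slotPotential {V : Type*} {c : ℕ} (A : Finset V)
    (g : V × Fin c → (V × Fin c) ⊕ V) : ℕ :=
  A.card + ∑ q ∈ A ×ˢ (Finset.univ : Finset (Fin c)), slotCost q.1 (g q)

theorem IsSlotFlow.update {V : Type*} [DecidableEq V] {c : ℕ} {r : V → V → Prop} {A X : Finset V}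
    {g : V × Fin c → (V × Fin c) ⊕ V} (hg : IsSlotFlow r A X g) {q : V × Fin c}
    {y : (V × Fin c) ⊕ V} (hy : ServedBy r A X q y) (hun : ∀ q', q'.1 ∈ A → g q' ≠ y) :
    IsSlotFlow r A X (Function.update g q y) := by
  refine ⟨fun q' h' => ?_, fun q₁ q₂ h1 h2 h => ?_⟩
  · by_cases e : q' = q
    · subst e; simpa using hy
    · simpa [Function.update_of_ne e] using hg.servedBy q' h'
  · by_cases e1 : q₁ = q <;> by_cases e2 : q₂ = q
    · rw [e1, e2]
    · rw [e1, Function.update_self, Function.update_of_ne e2] at h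
      exact absurd h.symm (hun _ h2)
    · rw [e2, Function.update_self, Function.update_of_ne e1] at h
      exact absurd h (hun _ h1)
    · rw [Function.update_of_ne e2, Function.update_of_ne e1] at h
      exact hg.inj _ _ h1 h2 h

theorem slotPotential_update_lt {V : Type*} [DecidableEq V] {c : ℕ} {A : Finset V}
    {g : V × Fin c → (V × Fin c) ⊕ V} {q : V × Fin c} (hq : q.1 ∈ A) {y : (V × Fin c) ⊕ V}
    (hlt : slotCost q.1 y < slotCost q.1 (g q)) :
    slotPotential A (Function.update g q y) < slotPotential A g := by
  unfold slotPotential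
  refine Nat.add_lt_add_left (Finset.sum_lt_sum (fun q' _ => ?_) ⟨q, by simp [hq], by simpa⟩) _
  by_cases e : q' = q
  · subst e; simpa using hlt.le
  · simp [Function.update_of_ne e]

/-- Counting the servers of the receiver slots in `R` shows that `R` obeys the cut condition. -/
theorem IsSlotFlow.card_le {V : Type*} [DecidableEq V] {c : ℕ} {r : V → V → Prop} {A X : Finset V}
    {g : V × Fin c → (V × Fin c) ⊕ V} (hg : IsSlotFlow r A X g) {R : Finset V} (hR : R ⊆ A) :
    c * (X ∩ R).card ≤ R.card + c * (rboundary r A R \ X).card := by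
  have h1 : (R ×ˢ (Finset.univ : Finset (Fin c))).card ≤
      ((((R \ X) ∪ (rboundary r A R \ X)) ×ˢ (Finset.univ : Finset (Fin c))).disjSum R).card := by
    refine Finset.card_le_card_of_injOn g (fun q hq => ?_) (fun q hq q' hq' h => ?_)
    · have hq1 : q.1 ∈ R := by simpa using hq
      have h := hg.servedBy q (hR hq1)
      rcases hs : g q with s | v
      · rw [hs] at h
        obtain ⟨ha, hx, h⟩ := h
        have : s.1 ∈ R ∨ s.1 ∈ rboundary r A R := by
          by_cases hsR : s.1 ∈ R
          · exact Or.inl hsR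
          · refine Or.inr (mem_rboundary.2 ⟨ha, hsR, q.1, hq1, h.resolve_left fun e => ?_⟩)
            exact hsR (e ▸ hq1)
        simp only [Finset.mem_coe, Finset.inl_mem_disjSum, Finset.mem_product, Finset.mem_union,
          Finset.mem_sdiff, Finset.mem_univ, and_true]
        tauto
      · rw [hs] at h
        have h : v = q.1 := h
        simpa [h] using hq1
    · have hq1 : q.1 ∈ R := by simpa using hq
      have hq2 : q'.1 ∈ R := by simpa using hq'
      exact hg.inj q q' (hR hq1) (hR hq2) h
  have h2 : (R \ X).card + (X ∩ R).card = R.card := by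
    rw [Finset.inter_comm]; exact Finset.card_sdiff_add_card_inter R X
  have h3 := Finset.card_union_le (R \ X) (rboundary r A R \ X)
  simp only [Finset.card_product, Finset.card_univ, Fintype.card_fin, Finset.card_disjSum] at h1
  have h4 := Nat.mul_le_mul_right c h3
  rw [← h2] at h1 ⊢
  nlinarith

/-- Hall's theorem turns the cut condition into a flow. -/
theorem exists_isSlotFlow {V : Type*} [DecidableEq V] {c : ℕ} {r : V → V → Prop} {A X : Finset V}
    (h : ∀ R ⊆ A, c * (X ∩ R).card ≤ R.card + c * (rboundary r A R \ X).card) :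
    ∃ g : V × Fin c → (V × Fin c) ⊕ V, IsSlotFlow r A X g := by
  let N : A × Fin c → Finset ((V × Fin c) ⊕ V) := fun q =>
    ((open Classical in {u ∈ A \ X | u = q.1 ∨ r q.1 u} : Finset V) ×ˢ
      (Finset.univ : Finset (Fin c))).disjSum {(q.1 : V)}
  obtain ⟨g, hinj, hg⟩ := (Finset.all_card_le_biUnion_card_iff_exists_injective N).1 (by
    intro s
    set R : Finset V := s.image fun q => (q.1 : V) with hRdef
    have hR : R ⊆ A := by
      intro v hv
      obtain ⟨q, -, rfl⟩ := Finset.mem_image.1 hv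
      exact q.1.2
    have h1 : s.card ≤ (R ×ˢ (Finset.univ : Finset (Fin c))).card := by
      refine Finset.card_le_card_of_injOn (fun q => ((q.1 : V), q.2)) (fun q hq => ?_)
        (fun q _ q' _ e => ?_)
      · simp only [Finset.coe_product, Set.mem_prod, Finset.mem_coe, Finset.mem_univ, and_true]
        exact Finset.mem_image_of_mem _ hq
      · simp only [Prod.mk.injEq] at e
        exact Prod.ext (Subtype.ext e.1) e.2
    have h2 : (((R \ X) ∪ (rboundary r A R \ X)) ×ˢ (Finset.univ : Finset (Fin c))).disjSum R ⊆
        s.biUnion N := by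
      intro y hy
      rcases y with p | v
      · simp only [Finset.inl_mem_disjSum, Finset.mem_product, Finset.mem_union, Finset.mem_sdiff,
          Finset.mem_univ, and_true] at hy
        rcases hy with ⟨hp, hx⟩ | ⟨hp, hx⟩
        · obtain ⟨q, hq, e⟩ := Finset.mem_image.1 hp
          refine Finset.mem_biUnion.2 ⟨q, hq, ?_⟩
          simp [N, ← e] at hx ⊢
          exact hx
        · obtain ⟨ha, -, u, hu, hur⟩ := mem_rboundary.1 hp
          obtain ⟨q, hq, e⟩ := Finset.mem_image.1 hu
          refine Finset.mem_biUnion.2 ⟨q, hq, ?_⟩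
          simp only [N, Finset.inl_mem_disjSum, Finset.mem_product, Finset.mem_filter,
            Finset.mem_sdiff, Finset.mem_univ, and_true]
          exact ⟨⟨ha, hx⟩, Or.inr (e ▸ hur)⟩
      · have hv : v ∈ R := by simpa using hy
        obtain ⟨q, hq, e⟩ := Finset.mem_image.1 hv
        exact Finset.mem_biUnion.2 ⟨q, hq, by simp [N, e]⟩
    have h3 := Finset.card_le_card h2
    have h4 : Disjoint (R \ X) (rboundary r A R \ X) := by
      rw [Finset.disjoint_left]
      intro v hv hv'
      exact (mem_rboundary.1 (Finset.mem_sdiff.1 hv').1).2.1 (Finset.mem_sdiff.1 hv).1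
    have h5 : (R \ X).card + (X ∩ R).card = R.card := by
      rw [Finset.inter_comm]; exact Finset.card_sdiff_add_card_inter R X
    have h6 := h R hR
    simp only [Finset.card_disjSum, Finset.card_product, Finset.card_univ, Fintype.card_fin,
      Finset.card_union_of_disjoint h4] at h3 h1
    rw [← h5] at h1
    nlinarith)
  refine ⟨fun q => if hq : q.1 ∈ A then g (⟨q.1, hq⟩, q.2) else Sum.inr q.1, fun q hq => ?_,
    fun q q' hq hq' e => ?_⟩
  · have := hg (⟨q.1, hq⟩, q.2)
    simp only [hq, dif_pos]
    rcases hs : g (⟨q.1, hq⟩, q.2) with s | v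
    · rw [hs] at this
      simp [N] at this
      exact ⟨this.1.1, this.1.2, this.2⟩
    · rw [hs] at this
      simpa [N, ServedBy] using this
  · simp only [hq, hq', dif_pos] at e
    have := hinj e
    simp only [Prod.mk.injEq, Subtype.mk.injEq] at this
    exact Prod.ext this.1 this.2

/-- If the cut condition holds in `A`, then it already holds in a subset of `A` that contains `X`
and has exactly `c * #X` elements. A flow of least potential uses all the supply: a vertex with
unused supply would transmit nothing, and could be deleted. -/
theorem exists_subset_card_eq_mul {V : Type*} [DecidableEq V] {c : ℕ} (hc : 0 < c)
    {r : V → V → Prop} {A X : Finset V} (hXA : X ⊆ A)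
    (h : ∀ R ⊆ A, c * (X ∩ R).card ≤ R.card + c * (rboundary r A R \ X).card) :
    ∃ A', X ⊆ A' ∧ A' ⊆ A ∧ A'.card = c * X.card ∧
      ∀ R ⊆ A', c * (X ∩ R).card ≤ R.card + c * (rboundary r A' R \ X).card := by
  obtain ⟨g₀, hg₀⟩ := exists_isSlotFlow h
  obtain ⟨⟨A', g⟩, ⟨(hX : X ⊆ A'), (hA : A' ⊆ A), (hg : IsSlotFlow r A' X g)⟩, hmin⟩ :=
    WellFounded.has_min
    (measure fun p : Finset V × (V × Fin c → (V × Fin c) ⊕ V) => slotPotential p.1 p.2).wf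
    {p | X ⊆ p.1 ∧ p.1 ⊆ A ∧ IsSlotFlow r p.1 X p.2} ⟨(A, g₀), hXA, subset_rfl, hg₀⟩
  have hmin' : ∀ q : V × Fin c, q.1 ∈ A' → ∀ y, ServedBy r A' X q y →
      (∀ q', q'.1 ∈ A' → g q' ≠ y) → slotCost q.1 (g q) ≤ slotCost q.1 y := by
    intro q hq y hy hun
    by_contra! hlt
    exact hmin (A', Function.update g q y) ⟨hX, hA, hg.update hy hun⟩
      (slotPotential_update_lt hq hlt)
  -- If no slot at `v` pays anything, then the slots at `v` serve exactly one another.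
  have hidle : ∀ v ∈ A', (∀ j, slotCost v (g (v, j)) = 0) →
      v ∉ X ∧ ∀ i, ∃ j, g (v, j) = Sum.inl (v, i) := by
    intro v hv h0
    have h1 : ∀ j, ∃ i, g (v, j) = Sum.inl (v, i) := by
      intro j
      have := h0 j
      rcases hs : g (v, j) with s | w
      · rw [hs] at this
        have hsv : s.1 = v := by
          by_contra hne
          simp [slotCost, hne] at this
        exact ⟨s.2, by rw [← hsv]⟩
      · rw [hs] at this
        simp [slotCost] at this
    choose i hi using h1
    have hinj : Function.Injective i := fun j j' e => by
      have := hg.inj (v, j) (v, j') hv hv (by rw [hi, hi, e])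
      simpa using this
    refine ⟨?_, fun k => ?_⟩
    · have := hg.servedBy (v, ⟨0, hc⟩) hv
      rw [hi] at this
      exact this.2.1
    · obtain ⟨j, rfl⟩ := (Finite.injective_iff_surjective.1 hinj) k
      exact ⟨j, hi j⟩
  have hsender : ∀ v ∈ A', v ∉ X → ∀ i, ∃ q, q.1 ∈ A' ∧ g q = Sum.inl (v, i) := by
    intro v hv hvX i
    by_contra! hun
    obtain ⟨j, hj⟩ := (hidle v hv fun j => by
      have := hmin' (v, j) hv (Sum.inl (v, i)) ⟨hv, hvX, Or.inl rfl⟩ hun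
      simpa [slotCost] using this).2 i
    exact hun (v, j) hv hj
  have hsupply : ∀ v ∈ A', ∃ q, q.1 ∈ A' ∧ g q = Sum.inr v := by
    intro v hv
    by_contra! hun
    obtain ⟨hvX, hown⟩ := hidle v hv fun j => by
      have h1 := hmin' (v, j) hv (Sum.inr v) rfl hun
      have h2 := hg.servedBy (v, j) hv
      rcases hs : g (v, j) with s | w
      · rw [hs] at h1
        by_cases e : s.1 = v
        · simp [slotCost, e]
        · simp [slotCost, e] at h1
      · rw [hs] at h2
        have h2 : w = v := h2
        exact absurd (h2 ▸ hs) (hun (v, j) hv)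
    -- Nothing passes through `v`, so `v` can be deleted.
    have hgv : IsSlotFlow r (A'.erase v) X g := by
      refine ⟨fun q hq => ?_, fun q q' hq hq' =>
        hg.inj q q' (Finset.mem_of_mem_erase hq) (Finset.mem_of_mem_erase hq')⟩
      obtain ⟨hqv, hqA⟩ := Finset.mem_erase.1 hq
      have h2 := hg.servedBy q hqA
      rcases hs : g q with s | w
      · rw [hs] at h2
        refine ⟨Finset.mem_erase.2 ⟨fun e => ?_, h2.1⟩, h2.2⟩
        obtain ⟨j, hj⟩ := hown s.2
        have := hg.inj (v, j) q hv hqA (by rw [hj, hs, ← e])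
        exact hqv (by rw [← this])
      · rw [hs] at h2
        exact h2
    have hXv : X ⊆ A'.erase v := fun x hx => Finset.mem_erase.2 ⟨fun e => hvX (e ▸ hx), hX hx⟩
    refine hmin (A'.erase v, g) ⟨hXv, (Finset.erase_subset _ _).trans hA, hgv⟩ ?_
    change slotPotential _ _ < slotPotential _ _
    exact Nat.add_lt_add_of_lt_of_le (Finset.card_erase_lt_of_mem hv)
      (Finset.sum_le_sum_of_subset (Finset.product_subset_product_left (Finset.erase_subset _ _)))
  refine ⟨A', hX, hA, ?_, fun R hR => hg.card_le hR⟩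
  have himage : (A' ×ˢ (Finset.univ : Finset (Fin c))).image g =
      ((A' \ X) ×ˢ (Finset.univ : Finset (Fin c))).disjSum A' := by
    ext y
    simp only [Finset.mem_image, Finset.mem_product, Finset.mem_univ, and_true]
    constructor
    · rintro ⟨q, hq, rfl⟩
      have h2 := hg.servedBy q hq
      rcases hs : g q with s | w
      · rw [hs] at h2
        simp [h2.1, h2.2.1]
      · rw [hs] at h2
        have h2 : w = q.1 := h2
        simpa [h2] using hq
    · rcases y with s | w
      · intro hs
        simp only [Finset.inl_mem_disjSum, Finset.mem_product, Finset.mem_sdiff, Finset.mem_univ,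
          and_true] at hs
        exact hsender s.1 hs.1 hs.2 s.2
      · intro hw
        exact hsupply w (by simpa using hw)
  have hcard := congrArg Finset.card himage
  rw [Finset.card_image_of_injOn fun q hq q' hq' e => hg.inj q q'
    (Finset.mem_product.1 hq).1 (Finset.mem_product.1 hq').1 e] at hcard
  simp only [Finset.card_disjSum, Finset.card_product, Finset.card_univ, Fintype.card_fin] at hcard
  have h5 := Finset.card_sdiff_add_card_eq_card hX
  rw [← h5] at hcard ⊢
  nlinarith

/-! ### Havens and balanced separators -/

/-- A haven of order `K` in the graph with vertex set `U` and adjacency `r`: it assigns to each set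
`Y` of at most `K` vertices a nonempty connected set `β Y ⊆ U \ Y` all of whose neighbours are in
`Y`, such that `β X ⊆ β Y` whenever `Y` does not meet `β X`. Connectedness is expressed by
`subset_of_closed`. -/
structure IsHaven {V : Type*} [DecidableEq V] (r : V → V → Prop) (U : Finset V) (K : ℕ)
    (β : Finset V → Finset V) : Prop where
  nonempty : ∀ Y ⊆ U, Y.card ≤ K → (β Y).Nonempty
  subset : ∀ Y ⊆ U, Y.card ≤ K → β Y ⊆ U \ Y
  closed : ∀ Y ⊆ U, Y.card ≤ K → ∀ u ∈ β Y, ∀ v ∈ U, v ∉ Y → r u v → v ∈ β Y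
  subset_of_closed : ∀ Y ⊆ U, Y.card ≤ K → ∀ Z ⊆ U,
    (∀ u ∈ Z, ∀ v ∈ U, v ∉ Y → r u v → v ∈ Z) → (β Y ∩ Z).Nonempty → β Y ⊆ Z
  consistent : ∀ X ⊆ U, X.card ≤ K → ∀ Y ⊆ U, Y.card ≤ K → Disjoint (β X) Y → β X ⊆ β Y

/-- Every nonempty set `F` of vertices in `U` has a subset `S` with at most `a` elements such that
each component of `F \ S` has at most `2 #F / 3` elements. Components are replaced by unions `D` of
components, one for each vertex. -/
def HasBalancedSeparators {V : Type*} [DecidableEq V] (r : V → V → Prop) (U : Finset V) (a : ℕ) :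
    Prop :=
  ∀ F ⊆ U, F.Nonempty → ∃ S ⊆ F, S.card ≤ a ∧ ∀ v ∈ F \ S, ∃ D ⊆ F \ S, v ∈ D ∧
    3 * D.card ≤ 2 * F.card ∧ ∀ u ∈ D, ∀ w ∈ F \ S, r u w → w ∈ D

section Haven

variable {V : Type*} [DecidableEq V] {r : V → V → Prop} {U : Finset V} {K a c : ℕ}
  {β : Finset V → Finset V}

/-- If `Y ∪ β Y` had at most `K` elements, then `β (Y ∪ β Y)` would be contained in `β Y`, from
which it is disjoint. -/
theorem IsHaven.lt_card_add_card (hβ : IsHaven r U K β) {Y : Finset V} (hY : Y ⊆ U)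
    (hYK : Y.card ≤ K) : K < Y.card + (β Y).card := by
  by_contra! hle
  have hsub := hβ.subset Y hY hYK
  have hU : Y ∪ β Y ⊆ U := Finset.union_subset hY (hsub.trans Finset.sdiff_subset)
  have hK : (Y ∪ β Y).card ≤ K := (Finset.card_union_le _ _).trans hle
  obtain ⟨v, hv⟩ := hβ.nonempty _ hU hK
  have hd := hβ.subset _ hU hK
  have hsub' : β (Y ∪ β Y) ⊆ β Y := hβ.consistent _ hU hK Y hY hYK (by
    rw [Finset.disjoint_left]
    intro w hw hwY
    exact (Finset.mem_sdiff.1 (hd hw)).2 (Finset.mem_union_left _ hwY))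
  exact (Finset.mem_sdiff.1 (hd hv)).2 (Finset.mem_union_right _ (hsub' hv))

/-- A separator `X` of order at most `12 a` that minimises `c * #X + #(β X)`, for a price `c` chosen
so that the minimum exceeds `6 c a`. -/
theorem IsHaven.exists_minimizer (hβ : IsHaven r U (13 * a) β) (ha : 0 < a) :
    ∃ c X, 0 < c ∧ X ⊆ U ∧ X.card ≤ 12 * a ∧ 6 * c * a < c * X.card + (β X).card ∧
      ∀ Y ⊆ U, Y.card ≤ 13 * a → c * X.card + (β X).card ≤ c * Y.card + (β Y).card := by
  set P : ℕ → Prop := fun c => ∀ Y ⊆ U, Y.card ≤ 13 * a → 6 * c * a < c * Y.card + (β Y).card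
    with hP
  have h1 : P 1 := fun Y hY hYK => by
    have := hβ.lt_card_add_card hY hYK
    omega
  -- `6 (c + 1) a ≤ 12 c a`.
  obtain ⟨c, hc, hPc, hPc'⟩ : ∃ c, 0 < c ∧ P c ∧ ¬ P (c + 1) := by
    by_contra! hcon
    have hall : ∀ n, P (n + 1) := fun n => by
      induction n with
      | zero => exact h1
      | succ n ih => exact hcon _ n.succ_pos ih
    have h2 := hall U.card ∅ (Finset.empty_subset _) (by simp)
    have h3 := Finset.card_le_card
      ((hβ.subset ∅ (Finset.empty_subset _) (by simp)).trans Finset.sdiff_subset)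
    simp only [Finset.card_empty, mul_zero, zero_add] at h2
    nlinarith
  obtain ⟨X, hX, hmin⟩ := Finset.exists_min_image {Y ∈ U.powerset | Y.card ≤ 13 * a}
    (fun Y => c * Y.card + (β Y).card) ⟨∅, by simp⟩
  simp only [Finset.mem_filter, Finset.mem_powerset, and_imp] at hX hmin
  simp only [hP, not_forall, not_lt] at hPc'
  obtain ⟨Y₀, hY₀, hYK₀, hle⟩ := hPc'
  refine ⟨c, X, hc, hX.1, ?_, hPc X hX.1 hX.2, hmin⟩
  have h4 := hmin Y₀ hY₀ hYK₀
  have h5 : c * X.card ≤ c * (12 * a) := by nlinarith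
  exact Nat.le_of_mul_le_mul_left h5 hc

/-- A minimiser `X` of `c * #X + #(β X)` satisfies the cut condition outside `β X`: if `R` violated
it, exchanging `X ∩ R` for the neighbourhood of `R` would give a better separator. -/
theorem IsHaven.cut_condition (hβ : IsHaven r U K β) {X : Finset V} (hX : X ⊆ U)
    (hXK : X.card ≤ K)
    (hmin : ∀ Y ⊆ U, Y.card ≤ K → c * X.card + (β X).card ≤ c * Y.card + (β Y).card)
    {R : Finset V} (hR : R ⊆ U \ β X) :
    c * (X ∩ R).card ≤ R.card + c * (rboundary r (U \ β X) R \ X).card := by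
  by_contra! hlt
  have hsubX := hβ.subset X hX hXK
  set Q := rboundary r (U \ β X) R with hQ
  set Y := (Q \ X) ∪ (X \ R) with hYdef
  have hQU : Q ⊆ U \ β X := fun v hv => (mem_rboundary.1 hv).1
  have hYU : Y ⊆ U := Finset.union_subset
    (Finset.sdiff_subset.trans (hQU.trans Finset.sdiff_subset)) (Finset.sdiff_subset.trans hX)
  have hsplit : (X \ R).card + (X ∩ R).card = X.card := Finset.card_sdiff_add_card_inter X R
  have hYcard : Y.card ≤ (Q \ X).card + (X \ R).card := Finset.card_union_le _ _
  have h1 : (Q \ X).card < (X ∩ R).card := by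
    by_contra! hge
    have := Nat.mul_le_mul_left c hge
    omega
  have hYK : Y.card ≤ K := by omega
  have hdisj : Disjoint (β X) Y := by
    rw [Finset.disjoint_left]
    intro v hv hvY
    rcases Finset.mem_union.1 hvY with h | h
    · exact (Finset.mem_sdiff.1 (hQU (Finset.mem_sdiff.1 h).1)).2 hv
    · exact (Finset.mem_sdiff.1 (hsubX hv)).2 (Finset.mem_sdiff.1 h).1
  have hXY := hβ.consistent X hX hXK Y hYU hYK hdisj
  obtain ⟨v₀, hv₀⟩ := hβ.nonempty X hX hXK
  have hsub : β Y ⊆ β X ∪ R := by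
    refine hβ.subset_of_closed Y hYU hYK _ (Finset.union_subset
      (hsubX.trans Finset.sdiff_subset) (hR.trans Finset.sdiff_subset)) ?_
      ⟨v₀, Finset.mem_inter.2 ⟨hXY hv₀, Finset.mem_union_left _ hv₀⟩⟩
    intro u hu v hv hvY huv
    by_contra hvn
    have hv1 : v ∉ β X := fun h => hvn (Finset.mem_union_left _ h)
    have hv2 : v ∉ R := fun h => hvn (Finset.mem_union_right _ h)
    have hvX : v ∉ X := fun h =>
      hvY (Finset.mem_union_right _ (Finset.mem_sdiff.2 ⟨h, hv2⟩))
    rcases Finset.mem_union.1 hu with hu | hu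
    · exact hv1 (hβ.closed X hX hXK u hu v hv hvX huv)
    · refine hvY (Finset.mem_union_left _ (Finset.mem_sdiff.2 ⟨?_, hvX⟩))
      exact mem_rboundary.2 ⟨Finset.mem_sdiff.2 ⟨hv, hv1⟩, hv2, u, hu, huv⟩
  have h2 := Finset.card_le_card hsub
  have h3 := Finset.card_union_le (β X) R
  have h4 := hmin Y hYU hYK
  have h5 : c * Y.card ≤ c * (Q \ X).card + c * (X \ R).card := by
    rw [← mul_add]; exact Nat.mul_le_mul_left c hYcard
  have h6 : c * X.card = c * (X \ R).card + c * (X ∩ R).card := by rw [← mul_add, hsplit]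
  omega

/-- Balanced separators of order `a` in all induced subgraphs preclude a haven of order `13 a`.
For `a > 0`, the set to be separated is `F = β X ∪ A'`, where `X` is the minimiser above and `A'`
sends `c` units of flow to each vertex of `X`. -/
theorem IsHaven.false_of_hasBalancedSeparators (hβ : IsHaven r U (13 * a) β)
    (hsep : HasBalancedSeparators r U a) : False := by
  rcases Nat.eq_zero_or_pos a with rfl | ha
  -- For `a = 0` the set `β ∅` itself has no balanced separator, being connected.
  · have h0 : ((∅ : Finset V)).card ≤ 13 * 0 := by simp
    have hsub := hβ.subset ∅ (Finset.empty_subset _) h0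
    obtain ⟨v, hv⟩ := hβ.nonempty ∅ (Finset.empty_subset _) h0
    obtain ⟨S, -, hScard, hS⟩ := hsep (β ∅) (hsub.trans Finset.sdiff_subset) ⟨v, hv⟩
    obtain rfl : S = ∅ := by simpa using hScard
    obtain ⟨D, hDsub, hvD, hD, hDcl⟩ := hS v (by simpa using hv)
    rw [Finset.sdiff_empty] at hDsub hDcl
    have h1 := hβ.subset_of_closed ∅ (Finset.empty_subset _) h0 D
      (hDsub.trans (hsub.trans Finset.sdiff_subset))
      (fun u hu w hw _ huw => hDcl u hu w (hβ.closed ∅ (Finset.empty_subset _) h0 u (hDsub hu) w hw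
        (Finset.notMem_empty _) huw) huw) ⟨v, Finset.mem_inter.2 ⟨hv, hvD⟩⟩
    have h2 := Finset.card_le_card h1
    have h3 := Finset.card_pos.2 ⟨v, hv⟩
    omega
  obtain ⟨c, X, hc, hX, hX12, hlt, hmin⟩ := hβ.exists_minimizer ha
  have hX13 : X.card ≤ 13 * a := by omega
  have hsubX := hβ.subset X hX hX13
  obtain ⟨A', hXA', hA', hA'card, hcut⟩ := exists_subset_card_eq_mul hc (r := r)
    (A := U \ β X) (X := X)
    (fun v hv => Finset.mem_sdiff.2 ⟨hX hv, fun h => (Finset.mem_sdiff.1 (hsubX h)).2 hv⟩)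
    (fun R hR => hβ.cut_condition hX hX13 hmin hR)
  have hdis : Disjoint (β X) A' := by
    rw [Finset.disjoint_left]
    exact fun v hv hv' => (Finset.mem_sdiff.1 (hA' hv')).2 hv
  set F := β X ∪ A' with hF
  have hFcard : F.card = c * X.card + (β X).card := by
    rw [hF, Finset.card_union_of_disjoint hdis, hA'card, add_comm]
  have hFU : F ⊆ U := Finset.union_subset (hsubX.trans Finset.sdiff_subset)
    (hA'.trans Finset.sdiff_subset)
  obtain ⟨S, hSF, hScard, hS⟩ := hsep F hFU
    ((hβ.nonempty X hX hX13).mono Finset.subset_union_left)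
  have hSU := hSF.trans hFU
  -- `X ∪ S` points to the component `D` of `F \ S` to which the haven belongs.
  have hXS : X ∪ S ⊆ U := Finset.union_subset hX hSU
  have hXScard : (X ∪ S).card ≤ 13 * a := (Finset.card_union_le _ _).trans (by omega)
  have hsubXS := hβ.subset _ hXS hXScard
  obtain ⟨v, hv⟩ := hβ.nonempty _ hXS hXScard
  have hvX : v ∈ β X := hβ.consistent _ hXS hXScard X hX hX13 (by
    rw [Finset.disjoint_left]
    exact fun w hw hwX => (Finset.mem_sdiff.1 (hsubXS hw)).2 (Finset.mem_union_left _ hwX)) hv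
  have hvS : v ∉ S := fun h => (Finset.mem_sdiff.1 (hsubXS hv)).2 (Finset.mem_union_right _ h)
  obtain ⟨D, hDsub, hvD, hD, hDcl⟩ := hS v
    (Finset.mem_sdiff.2 ⟨Finset.mem_union_left _ hvX, hvS⟩)
  -- The vertices of `X` outside `D` are not needed to separate `D ∩ β X` from the rest.
  set X' := S ∪ (X ∩ D) with hX'
  have hX'U : X' ⊆ U := Finset.union_subset hSU (Finset.inter_subset_left.trans hX)
  have hX'XS : X' ⊆ X ∪ S := by
    intro w hw
    rcases Finset.mem_union.1 hw with h | h
    · exact Finset.mem_union_right _ h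
    · exact Finset.mem_union_left _ (Finset.mem_inter.1 h).1
  have hX'13 : X'.card ≤ 13 * a := (Finset.card_le_card hX'XS).trans hXScard
  have hvX' : v ∈ β X' := hβ.consistent _ hXS hXScard X' hX'U hX'13 (by
    rw [Finset.disjoint_left]
    exact fun w hw hwX => (Finset.mem_sdiff.1 (hsubXS hw)).2 (hX'XS hwX)) hv
  have hsub : β X' ⊆ D ∩ β X := by
    refine hβ.subset_of_closed X' hX'U hX'13 _
      (Finset.inter_subset_right.trans (hsubX.trans Finset.sdiff_subset)) ?_
      ⟨v, Finset.mem_inter.2 ⟨hvX', Finset.mem_inter.2 ⟨hvD, hvX⟩⟩⟩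
    intro u hu w hw hwX' huw
    obtain ⟨huD, huX⟩ := Finset.mem_inter.1 hu
    have hwS : w ∉ S := fun h => hwX' (Finset.mem_union_left _ h)
    by_cases hwX : w ∈ X
    · exact absurd (Finset.mem_union_right _ (Finset.mem_inter.2 ⟨hwX, hDcl u huD w
        (Finset.mem_sdiff.2 ⟨Finset.mem_union_right _ (hXA' hwX), hwS⟩) huw⟩)) hwX'
    · have hwβ := hβ.closed X hX hX13 u huX w hw hwX huw
      exact Finset.mem_inter.2 ⟨hDcl u huD w
        (Finset.mem_sdiff.2 ⟨Finset.mem_union_left _ hwβ, hwS⟩) huw, hwβ⟩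
  have h1 := hmin X' hX'U hX'13
  have h2 := Finset.card_le_card hsub
  have h3 : X'.card ≤ a + (X ∩ D).card := (Finset.card_union_le _ _).trans (by omega)
  have h4 := hcut (D ∩ A') Finset.inter_subset_right
  have h5 : X ∩ (D ∩ A') = X ∩ D := by
    ext w
    simp only [Finset.mem_inter]
    exact ⟨fun h => ⟨h.1, h.2.1⟩, fun h => ⟨h.1, h.2, hXA' h.1⟩⟩
  have h6 : rboundary r A' (D ∩ A') \ X ⊆ S := by
    intro w hw
    obtain ⟨hwA, hwn, u, hu, huw⟩ := mem_rboundary.1 (Finset.mem_sdiff.1 hw).1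
    by_contra hwS
    exact hwn (Finset.mem_inter.2 ⟨hDcl u (Finset.mem_inter.1 hu).1 w
      (Finset.mem_sdiff.2 ⟨Finset.mem_union_right _ hwA, hwS⟩) huw, hwA⟩)
  have h7 := Finset.card_le_card h6
  have h8 : (D ∩ β X).card + (D ∩ A').card ≤ D.card := by
    rw [← Finset.card_union_of_disjoint (hdis.mono Finset.inter_subset_right
      Finset.inter_subset_right)]
    exact Finset.card_le_card (Finset.union_subset Finset.inter_subset_left
      Finset.inter_subset_left)
  rw [h5] at h4
  have h9 := Nat.mul_le_mul_left c h3
  have h10 := Nat.mul_le_mul_left c (h7.trans hScard)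
  rw [mul_add] at h9
  have h11 : 6 * c * a = 6 * (c * a) := by ring
  omega

end Haven

/-! ### Big components and centroids -/

section BigPart

variable {W : Type*} {Γ : SimpleGraph W} {S X X₁ X₂ B B₁ B₂ : Set W}

/-- `B` is (the vertex set of) a component of `Γ[S] - X` with more than `2 |S| / 3` vertices.
Connectedness is expressed by `subset_of_closed`: a set that no edge of `Γ[S] - X` leaves contains
`B` as soon as it meets `B`. -/
structure IsBigPart (Γ : SimpleGraph W) (S X B : Set W) : Prop where
  subset : B ⊆ S \ X
  lt_ncard : 2 * S.ncard < 3 * B.ncard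
  closed : ∀ u ∈ B, ∀ v ∈ S \ X, Γ.Adj u v → v ∈ B
  subset_of_closed : ∀ Z : Set W, (∀ u ∈ Z, u ∈ S \ X → ∀ v ∈ S \ X, Γ.Adj u v → v ∈ Z) →
    (B ∩ Z).Nonempty → B ⊆ Z

/-- The only edge of `Γ[B]` between `Z` and its complement is `xy`, where `x ∈ Z`. -/
structure IsCutBy (Γ : SimpleGraph W) (B Z : Set W) (x y : W) : Prop where
  mem : x ∈ Z
  notMem : y ∉ Z
  eq_of_adj : ∀ u ∈ B, ∀ v ∈ B, Γ.Adj u v → u ∈ Z → v ∉ Z → u = x ∧ v = y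

theorem IsCutBy.compl {Z : Set W} {x y : W} (h : IsCutBy Γ B Z x y) : IsCutBy Γ B Zᶜ y x :=
  ⟨h.notMem, fun hx => hx h.mem, fun u hu v hv huv huZ hvZ =>
    (h.eq_of_adj v hv u hu huv.symm (not_not.1 hvZ) huZ).symm⟩

theorem mem_of_reachable_induce {T Z : Set W}
    (hZ : ∀ u ∈ Z, u ∈ T → ∀ v ∈ T, Γ.Adj u v → v ∈ Z) {u v : T}
    (h : (Γ.induce T).Reachable u v) (hu : (u : W) ∈ Z) : (v : W) ∈ Z := by
  obtain ⟨p⟩ := h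
  induction p with
  | nil => exact hu
  | cons hadj _ ih => exact ih (hZ _ hu (Subtype.prop _) _ (Subtype.prop _) hadj)

theorem exists_isBigPart [Finite W] (h : X.ncard < (Γ.induce S).sepNumber) :
    ∃ B, IsBigPart Γ S X B := by
  have hnot : ¬ (Γ.induce S).IsBalancedSeparator (Subtype.val ⁻¹' X) := fun hbal => by
    have h1 : (Γ.induce S).sepNumber ≤ (Subtype.val ⁻¹' X : Set S).ncard :=
      Nat.sInf_le ⟨_, hbal, rfl⟩
    have h2 : (Subtype.val ⁻¹' X : Set S).ncard ≤ X.ncard := by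
      rw [← Set.ncard_image_of_injective _ Subtype.val_injective]
      exact Set.ncard_le_ncard (Set.image_preimage_subset _ _) (Set.toFinite _)
    omega
  simp only [IsBalancedSeparator, not_forall, not_le] at hnot
  obtain ⟨C, hC⟩ := hnot
  refine ⟨(fun x : ↥(Subtype.val ⁻¹' X : Set S)ᶜ => (x : W)) '' C.supp, ⟨?_, ?_, ?_, ?_⟩⟩
  · rintro _ ⟨x, -, rfl⟩
    exact ⟨x.1.2, x.2⟩
  · rw [Set.ncard_image_of_injective (f := fun x : ↥(Subtype.val ⁻¹' X : Set S)ᶜ => (x : W)) _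
      (Subtype.val_injective.comp Subtype.val_injective)]
    rw [Nat.card_coe_set_eq, div_lt_iff₀ (by norm_num)] at hC
    have : ((2 * S.ncard : ℕ) : ℝ) < ((3 * C.supp.ncard : ℕ) : ℝ) := by
      push_cast
      linarith
    exact_mod_cast this
  · rintro _ ⟨x, hx, rfl⟩ v hv hadj
    refine ⟨⟨⟨v, hv.1⟩, hv.2⟩, ?_, rfl⟩
    exact C.mem_supp_of_adj_mem_supp hx hadj
  · rintro Z hZ ⟨_, ⟨x, hx, rfl⟩, hxZ⟩ _ ⟨y, hy, rfl⟩
    have hreach : ((Γ.induce S).induce (Subtype.val ⁻¹' X)ᶜ).Reachable x y :=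
      ConnectedComponent.exact (hx.trans hy.symm)
    exact mem_of_reachable_induce (Γ := Γ.induce S) (Z := Subtype.val ⁻¹' Z)
      (fun u hu huT v hv hadj => hZ _ hu ⟨u.2, huT⟩ _ ⟨v.2, hv⟩ hadj) hreach hxZ

theorem IsBigPart.inter_nonempty [Finite W] (h₁ : IsBigPart Γ S X₁ B₁)
    (h₂ : IsBigPart Γ S X₂ B₂) : (B₁ ∩ B₂).Nonempty := by
  rw [Set.nonempty_iff_ne_empty]
  intro h
  have h3 := Set.ncard_union_eq (Set.disjoint_iff_inter_eq_empty.2 h) (Set.toFinite _)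
    (Set.toFinite _)
  have h4 : (B₁ ∪ B₂).ncard ≤ S.ncard := Set.ncard_le_ncard
    (Set.union_subset (h₁.subset.trans Set.sdiff_subset) (h₂.subset.trans Set.sdiff_subset))
    (Set.toFinite _)
  have := h₁.lt_ncard
  have := h₂.lt_ncard
  omega

theorem IsBigPart.nonempty [Finite W] (h : IsBigPart Γ S X B) : B.Nonempty := by
  simpa using h.inter_nonempty h

theorem IsBigPart.subset_of_disjoint [Finite W] (h₁ : IsBigPart Γ S X₁ B₁)
    (h₂ : IsBigPart Γ S X₂ B₂) (h : Disjoint B₁ X₂) : B₁ ⊆ B₂ := by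
  have h3 : B₁ ⊆ B₁ ∩ B₂ := by
    refine h₁.subset_of_closed _ (fun u hu _ v hv hadj => ?_) ?_
    · have hv1 := h₁.closed u hu.1 v hv hadj
      exact ⟨hv1, h₂.closed u hu.2 v ⟨hv.1, Set.disjoint_left.1 h hv1⟩ hadj⟩
    · rw [← Set.inter_assoc, Set.inter_self]
      exact h₁.inter_nonempty h₂
  exact h3.trans Set.inter_subset_right

/-- The centroid of a tree: if each edge inside the big component `B` of `Γ[S] - X` is the only edge
of `B` across some cut, then one vertex suffices to break up `B`. Otherwise each vertex `z` of `B`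
has a big component of `B - z`, and for the vertex with the smallest such component, the next vertex
towards that component contradicts minimality. -/
theorem IsBigPart.exists_forall_not_isBigPart_insert [Finite W] (hB : IsBigPart Γ S X B)
    (hcut : ∀ z ∈ B, ∀ z' ∈ B, Γ.Adj z z' → ∃ Z, IsCutBy Γ B Z z' z) :
    ∃ z ∈ B, ∀ C, ¬ IsBigPart Γ S (insert z X) C := by
  by_contra! hcon
  choose! C hC using hcon
  have hCB : ∀ z ∈ B, C z ⊆ B := fun z hz => (hC z hz).subset_of_disjoint hB
    (Set.disjoint_left.2 fun v hv hvX => ((hC z hz).subset hv).2 (Set.mem_insert_of_mem _ hvX))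
  have hzC : ∀ z ∈ B, z ∉ C z := fun z hz h => ((hC z hz).subset h).2 (Set.mem_insert _ _)
  obtain ⟨z, hz, hmin⟩ := Set.exists_min_image B (fun z => (C z).ncard) (Set.toFinite _) hB.nonempty
  obtain ⟨z', hz', hadj⟩ : ∃ z' ∈ C z, Γ.Adj z z' := by
    by_contra! hno
    have hsub : B ⊆ C z := by
      refine hB.subset_of_closed _ (fun u hu _ v hv hadj => ?_) ?_
      · refine (hC z hz).closed u hu v ⟨hv.1, ?_⟩ hadj
        rintro (rfl | hvX)
        · exact hno u hu hadj.symm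
        · exact hv.2 hvX
      · exact (hB.inter_nonempty (hC z hz))
    exact hzC z hz (hsub hz)
  have hz'B := hCB z hz hz'
  by_cases hzC' : z ∈ C z'
  · obtain ⟨Z, ⟨hz'Z, hzZ, hZ⟩⟩ := hcut z hz z' hz'B hadj
    have h1 : C z ⊆ C z ∩ Z := by
      refine (hC z hz).subset_of_closed _ (fun u hu _ v hv huv => ?_) ⟨z', hz', hz', hz'Z⟩
      have hvC := (hC z hz).closed u hu.1 v hv huv
      refine ⟨hvC, by_contra fun hvZ => ?_⟩
      have := (hZ u (hCB z hz hu.1) v (hCB z hz hvC) huv hu.2 hvZ).2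
      exact hzC z hz (this ▸ hvC)
    have h2 : C z' ⊆ C z' ∩ Zᶜ := by
      refine (hC z' hz'B).subset_of_closed _ (fun u hu _ v hv huv => ?_) ⟨z, hzC', hzC', hzZ⟩
      have hvC := (hC z' hz'B).closed u hu.1 v hv huv
      refine ⟨hvC, fun hvZ => ?_⟩
      have := (hZ v (hCB z' hz'B hvC) u (hCB z' hz'B hu.1) huv.symm hvZ hu.2).1
      exact hzC z' hz'B (this ▸ hvC)
    obtain ⟨w, hw, hw'⟩ := (hC z hz).inter_nonempty (hC z' hz'B)
    exact (h2 hw').2 (h1 hw).2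
  · have hsub : C z' ⊆ C z := by
      refine (hC z' hz'B).subset_of_disjoint (hC z hz) (Set.disjoint_left.2 fun v hv hvX => ?_)
      rcases hvX with rfl | hvX
      · exact hzC' hv
      · exact ((hC z' hz'B).subset hv).2 (Set.mem_insert_of_mem _ hvX)
    have hlt : (C z').ncard < (C z).ncard := Set.ncard_lt_ncard
      (Set.ssubset_iff_subset_ne.2 ⟨hsub, fun e => hzC z' hz'B (e ▸ hz')⟩) (Set.toFinite _)
    exact absurd (hmin z' hz'B) (not_le.2 hlt)

end BigPart

/-! ### Separation numbers and balanced separators -/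

/-- The separation number of induced subgraphs bounds the balanced separators in the formulation
with sets. -/
theorem hasBalancedSeparators_of_sepNumber_le {V : Type*} [DecidableEq V] [Finite V]
    {G : SimpleGraph V} {r : V → V → Prop} (hr : ∀ u v, r u v → G.Adj u v) {U : Finset V} {a : ℕ}
    (h : ∀ F ⊆ U, F.Nonempty → (G.induce (F : Set V)).sepNumber ≤ a) :
    HasBalancedSeparators r U a := by
  classical
  intro F hF hFne
  obtain ⟨X, hX, hXcard⟩ := (G.induce (F : Set V)).exists_isBalancedSeparator_ncard_eq
  have hXfin : (Subtype.val '' X).Finite := Set.toFinite _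
  refine ⟨hXfin.toFinset, ?_, ?_, ?_⟩
  · intro v hv
    obtain ⟨x, -, rfl⟩ := (Set.Finite.mem_toFinset _).1 hv
    exact x.2
  · rw [← Set.ncard_eq_toFinset_card _ hXfin,
      Set.ncard_image_of_injective _ Subtype.val_injective, hXcard]
    exact h F hF hFne
  intro v hv
  obtain ⟨hvF, hvX⟩ := Finset.mem_sdiff.1 hv
  have hvX' : (⟨v, hvF⟩ : (F : Set V)) ∈ Xᶜ := fun hmem => hvX (by
    rw [Set.Finite.mem_toFinset]; exact ⟨_, hmem, rfl⟩)
  set C := ((G.induce (F : Set V)).induce Xᶜ).connectedComponentMk ⟨⟨v, hvF⟩, hvX'⟩ with hC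
  have hDfin : ((fun x : ↥Xᶜ => (x : V)) '' C.supp).Finite := Set.toFinite _
  refine ⟨hDfin.toFinset, ?_, ?_, ?_, ?_⟩
  · intro w hw
    obtain ⟨x, -, rfl⟩ := (Set.Finite.mem_toFinset _).1 hw
    refine Finset.mem_sdiff.2 ⟨x.1.2, fun hmem => ?_⟩
    obtain ⟨y, hy, e⟩ := (Set.Finite.mem_toFinset _).1 hmem
    exact x.2 (Subtype.ext e ▸ hy)
  · rw [Set.Finite.mem_toFinset]
    exact ⟨⟨⟨v, hvF⟩, hvX'⟩, rfl, rfl⟩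
  · rw [← Set.ncard_eq_toFinset_card _ hDfin,
      Set.ncard_image_of_injective (f := fun x : ↥Xᶜ => (x : V)) _
        (Subtype.val_injective.comp Subtype.val_injective)]
    have h1 := hX C
    rw [Nat.card_coe_set_eq, Set.ncard_coe_finset, le_div_iff₀ (by norm_num)] at h1
    have : ((3 * C.supp.ncard : ℕ) : ℝ) ≤ ((2 * F.card : ℕ) : ℝ) := by
      push_cast
      linarith
    exact_mod_cast this
  · intro u hu w hw huw
    obtain ⟨x, hx, rfl⟩ := (Set.Finite.mem_toFinset _).1 hu
    obtain ⟨hwF, hwX⟩ := Finset.mem_sdiff.1 hw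
    rw [Set.Finite.mem_toFinset]
    refine ⟨⟨⟨w, hwF⟩, fun hmem => hwX ?_⟩, ?_, rfl⟩
    · rw [Set.Finite.mem_toFinset]; exact ⟨_, hmem, rfl⟩
    · exact C.mem_supp_of_adj_mem_supp hx (hr _ _ huw)

/-! ### Paths of a subdivision -/

section Subdivision

variable {V : Type*} {G : SimpleGraph V} {k : G.edgeSet → ℕ} {S : Set (G.SubdivVertex k)}

theorem subdivPath_zero (e : G.edgeSet) :
    G.subdivPath k e 0 = Sum.inl (Quot.out (e : Sym2 V)).1 := by
  simp [subdivPath]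

theorem subdivPath_last (e : G.edgeSet) :
    G.subdivPath k e (k e + 1) = Sum.inl (Quot.out (e : Sym2 V)).2 := by
  simp [subdivPath]

theorem subdivPath_inner (e : G.edgeSet) (j : Fin (k e)) :
    G.subdivPath k e (j + 1) = Sum.inr ⟨e, j⟩ := by
  simp [subdivPath]

theorem adj_out (e : G.edgeSet) : G.Adj (Quot.out (e : Sym2 V)).1 (Quot.out (e : Sym2 V)).2 := by
  have h : s((Quot.out (e : Sym2 V)).1, (Quot.out (e : Sym2 V)).2) = (e : Sym2 V) :=
    Quot.out_eq (e : Sym2 V)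
  rw [← mem_edgeSet, h]
  exact e.2

theorem eq_zero_or_last_or_inner {n i : ℕ} (hi : i ≤ n + 1) :
    i = 0 ∨ i = n + 1 ∨ ∃ j : Fin n, i = j + 1 := by
  rcases Nat.eq_zero_or_pos i with h | h
  · exact Or.inl h
  · by_cases h' : i = n + 1
    · exact Or.inr (Or.inl h')
    · exact Or.inr (Or.inr ⟨⟨i - 1, by omega⟩, by simp; omega⟩)

theorem subdivPath_eq_inr {e e' : G.edgeSet} {i : ℕ} {j : Fin (k e)}
    (h : G.subdivPath k e' i = Sum.inr ⟨e, j⟩) : e' = e ∧ i = j + 1 := by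
  unfold subdivPath at h
  split_ifs at h with h0 h1
  simp only [Sum.inr.injEq, Sigma.mk.injEq] at h
  obtain ⟨rfl, h⟩ := h
  have := congrArg Fin.val (eq_of_heq h)
  simp only at this
  exact ⟨rfl, by omega⟩

theorem subdivPath_injOn {e : G.edgeSet} {i j : ℕ} (hi : i ≤ k e + 1) (hj : j ≤ k e + 1)
    (h : G.subdivPath k e i = G.subdivPath k e j) : i = j := by
  have hne := (adj_out e).ne
  rcases eq_zero_or_last_or_inner hi with rfl | rfl | ⟨l, rfl⟩
  · rcases eq_zero_or_last_or_inner hj with rfl | rfl | ⟨m, rfl⟩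
    · rfl
    · rw [subdivPath_zero, subdivPath_last, Sum.inl.injEq] at h
      exact absurd h hne
    · rw [subdivPath_inner] at h
      exact (subdivPath_eq_inr h).2
  · rcases eq_zero_or_last_or_inner hj with rfl | rfl | ⟨m, rfl⟩
    · rw [subdivPath_zero, subdivPath_last, Sum.inl.injEq] at h
      exact absurd h.symm hne
    · rfl
    · rw [subdivPath_inner] at h
      exact (subdivPath_eq_inr h).2
  · rw [subdivPath_inner] at h
    exact (subdivPath_eq_inr h.symm).2.symm

/-- The neighbours of a new vertex are its two neighbours on the path of its edge. -/
theorem eq_of_subdivide_adj_inner {e : G.edgeSet} {l : ℕ} (hl : l + 1 ≤ k e)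
    {v : G.SubdivVertex k} (h : (G.subdivide k).Adj (G.subdivPath k e (l + 1)) v) :
    v = G.subdivPath k e l ∨ v = G.subdivPath k e (l + 2) := by
  obtain ⟨e', i, hi, h⟩ := h
  have hin : G.subdivPath k e (l + 1) = Sum.inr ⟨e, ⟨l, hl⟩⟩ := subdivPath_inner e ⟨l, hl⟩
  rcases Sym2.eq_iff.1 h with ⟨h1, h2⟩ | ⟨h1, h2⟩
  · obtain ⟨rfl, rfl⟩ := subdivPath_eq_inr (h1.symm.trans hin)
    exact Or.inr h2
  · obtain ⟨rfl, h3⟩ := subdivPath_eq_inr (h1.symm.trans hin)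
    obtain rfl : i = l := by simpa using h3
    exact Or.inl h2

theorem subdivide_adj_succ (e : G.edgeSet) {i : ℕ} (hi : i ≤ k e) :
    (G.subdivide k).Adj (G.subdivPath k e i) (G.subdivPath k e (i + 1)) :=
  ⟨e, i, hi, rfl⟩

/-! ### Full edges -/

/-- The whole path that replaces the edge `e` lies in `S`. -/
def IsFullEdge (S : Set (G.SubdivVertex k)) (e : G.edgeSet) : Prop :=
  ∀ i ≤ k e + 1, G.subdivPath k e i ∈ S

/-- `u` and `v` are the ends of an edge of `G` whose path lies in `S`: the adjacency of the graph of
which the subgraph of the subdivision induced by `S` is a subdivision, up to dangling paths. -/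
def FullAdj (S : Set (G.SubdivVertex k)) (u v : V) : Prop :=
  ∃ e, IsFullEdge S e ∧
    ((G.subdivPath k e 0 = Sum.inl u ∧ G.subdivPath k e (k e + 1) = Sum.inl v) ∨
      (G.subdivPath k e 0 = Sum.inl v ∧ G.subdivPath k e (k e + 1) = Sum.inl u))

theorem FullAdj.adj {u v : V} (h : FullAdj S u v) : G.Adj u v := by
  obtain ⟨e, -, ⟨h1, h2⟩ | ⟨h1, h2⟩⟩ := h <;>
  · rw [subdivPath_zero, Sum.inl.injEq] at h1
    rw [subdivPath_last, Sum.inl.injEq] at h2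
    subst h1 h2
    first
      | exact adj_out e
      | exact (adj_out e).symm

/-- A set `B` that avoids the branch vertices with full edges induces a forest: some vertex of the
path of `e` is missing from `B`, and the vertices of the path from there to a given edge of the path
form one side of a cut. -/
theorem exists_isCutBy {B : Set (G.SubdivVertex k)} (hBS : B ⊆ S)
    (hB : ∀ u v, FullAdj S u v → Sum.inl u ∉ B) {z z' : G.SubdivVertex k} (hz : z ∈ B)
    (hz' : z' ∈ B) (hadj : (G.subdivide k).Adj z z') :
    ∃ Z, IsCutBy (G.subdivide k) B Z z' z := by
  have key : ∀ (e : G.edgeSet) (i : ℕ), i ≤ k e → G.subdivPath k e i ∈ B →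
      G.subdivPath k e (i + 1) ∈ B →
      (∃ Z, IsCutBy (G.subdivide k) B Z (G.subdivPath k e i) (G.subdivPath k e (i + 1))) ∨
      (∃ Z, IsCutBy (G.subdivide k) B Z (G.subdivPath k e (i + 1)) (G.subdivPath k e i)) := by
    intro e i hi hiB hiB'
    obtain ⟨j, hj, hjB⟩ : ∃ j ≤ k e + 1, G.subdivPath k e j ∉ B := by
      by_contra! hall
      refine hB _ _ ⟨e, fun i hi => hBS (hall i hi), Or.inl ⟨subdivPath_zero e,
        subdivPath_last e⟩⟩ ?_
      rw [← subdivPath_zero]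
      exact hall 0 (Nat.zero_le _)
    have hji : j ≠ i := fun h => hjB (h ▸ hiB)
    have hji' : j ≠ i + 1 := fun h => hjB (h ▸ hiB')
    rcases Nat.lt_or_ge j i with hlt | hge
    · refine Or.inl ⟨{x | ∃ l, j < l ∧ l ≤ i ∧ x = G.subdivPath k e l},
        ⟨i, hlt, le_rfl, rfl⟩, ?_, ?_⟩
      · rintro ⟨l, -, hl, h⟩
        have := subdivPath_injOn (by omega) (by omega) h
        omega
      · rintro _ - v hv huv ⟨l, hjl, hli, rfl⟩ hvZ
        obtain ⟨l, rfl⟩ : ∃ m, l = m + 1 := ⟨l - 1, by omega⟩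
        rcases eq_of_subdivide_adj_inner (by omega) huv with rfl | rfl
        · by_cases hlj : j = l
          · exact absurd (hlj ▸ hv) hjB
          · exact absurd ⟨l, by omega, by omega, rfl⟩ hvZ
        · by_cases hli' : l + 1 = i
          · subst hli'
            exact ⟨rfl, rfl⟩
          · exact absurd ⟨l + 2, by omega, by omega, rfl⟩ hvZ
    · refine Or.inr ⟨{x | ∃ l, i < l ∧ l < j ∧ x = G.subdivPath k e l},
        ⟨i + 1, by omega, by omega, rfl⟩, ?_, ?_⟩
      · rintro ⟨l, hl, hl', h⟩
        have := subdivPath_injOn (by omega) (by omega) h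
        omega
      · rintro _ - v hv huv ⟨l, hil, hlj, rfl⟩ hvZ
        obtain ⟨l, rfl⟩ : ∃ m, l = m + 1 := ⟨l - 1, by omega⟩
        rcases eq_of_subdivide_adj_inner (by omega) huv with rfl | rfl
        · by_cases hli' : l = i
          · subst hli'
            exact ⟨rfl, rfl⟩
          · exact absurd ⟨l, by omega, by omega, rfl⟩ hvZ
        · by_cases hlj' : j = l + 2
          · exact absurd (hlj' ▸ hv) hjB
          · exact absurd ⟨l + 2, by omega, by omega, rfl⟩ hvZ
  obtain ⟨e, i, hi, h⟩ := hadj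
  rcases Sym2.eq_iff.1 h with ⟨rfl, rfl⟩ | ⟨rfl, rfl⟩
  · rcases key e i hi hz hz' with ⟨Z, hZ⟩ | ⟨Z, hZ⟩
    · exact ⟨_, hZ.compl⟩
    · exact ⟨Z, hZ⟩
  · rcases key e i hi hz' hz with ⟨Z, hZ⟩ | ⟨Z, hZ⟩
    · exact ⟨Z, hZ⟩
    · exact ⟨_, hZ.compl⟩

/-- A big part contains both or none of the ends of a full edge whose ends are not deleted. -/
theorem IsBigPart.mem_of_fullAdj {Y : Set V} {B : Set (G.SubdivVertex k)}
    (hB : IsBigPart (G.subdivide k) S (Sum.inl '' Y) B) {u v : V} (huv : FullAdj S u v)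
    (hu : Sum.inl u ∈ B) (hv : v ∉ Y) : Sum.inl v ∈ B := by
  have huY : u ∉ Y := fun h => (hB.subset hu).2 ⟨u, h, rfl⟩
  obtain ⟨e, he, hends⟩ := huv
  have hmem : ∀ i ≤ k e + 1, G.subdivPath k e i ∈ S \ Sum.inl '' Y := by
    refine fun i hi => ⟨he i hi, ?_⟩
    rintro ⟨y, hy, h⟩
    rcases eq_zero_or_last_or_inner hi with rfl | rfl | ⟨l, rfl⟩
    · rcases hends with ⟨h1, -⟩ | ⟨h1, -⟩ <;> rw [h1, Sum.inl.injEq] at h <;> subst h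
      exacts [huY hy, hv hy]
    · rcases hends with ⟨-, h1⟩ | ⟨-, h1⟩ <;> rw [h1, Sum.inl.injEq] at h <;> subst h
      exacts [hv hy, huY hy]
    · rw [subdivPath_inner] at h
      exact absurd h (by simp)
  have hiff : ∀ i ≤ k e + 1, (G.subdivPath k e 0 ∈ B ↔ G.subdivPath k e i ∈ B) := by
    intro i hi
    induction i with
    | zero => rfl
    | succ i ih =>
      refine (ih (by omega)).trans ⟨fun h => ?_, fun h => ?_⟩
      · exact hB.closed _ h _ (hmem _ hi) (subdivide_adj_succ e (by omega))
      · exact hB.closed _ h _ (hmem _ (by omega)) (subdivide_adj_succ e (by omega)).symm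
  have := hiff (k e + 1) le_rfl
  rcases hends with ⟨h1, h2⟩ | ⟨h1, h2⟩ <;> rw [h1, h2] at this
  exacts [this.1 hu, this.2 hu]

/-- A set `Z` of branch vertices closed under full edges outside `Y` is the trace of a set of
vertices of the subdivision that is closed under adjacency in `S` outside `Y`: the one obtained by
adding all the stretches of paths in `S` that start in `Z`. -/
theorem IsBigPart.inl_mem_of_closed {Y Z : Set V} {B : Set (G.SubdivVertex k)}
    (hB : IsBigPart (G.subdivide k) S (Sum.inl '' Y) B)
    (hZ : ∀ u ∈ Z, ∀ v, v ∉ Y → FullAdj S u v → v ∈ Z) {u : V} (huZ : u ∈ Z)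
    (huB : Sum.inl u ∈ B) {v : V} (hv : Sum.inl v ∈ B) : v ∈ Z := by
  set P : G.edgeSet → ℕ → Prop := fun e i =>
    ((∃ w ∈ Z, G.subdivPath k e 0 = Sum.inl w) ∧ ∀ j ≤ i, G.subdivPath k e j ∈ S) ∨
    ((∃ w ∈ Z, G.subdivPath k e (k e + 1) = Sum.inl w) ∧
      ∀ j, i ≤ j → j ≤ k e + 1 → G.subdivPath k e j ∈ S) with hP
  set T : Set (G.SubdivVertex k) :=
    {x | Sum.elim (fun w => w ∈ Z) (fun y => P y.1 (y.2 + 1)) x} with hT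
  have hTP : ∀ e, ∀ i ≤ k e + 1, G.subdivPath k e i ∈ T → G.subdivPath k e i ∈ S → P e i := by
    intro e i hi hiT hiS
    rcases eq_zero_or_last_or_inner hi with rfl | rfl | ⟨l, rfl⟩
    · rw [subdivPath_zero] at hiT
      exact Or.inl ⟨⟨_, hiT, subdivPath_zero e⟩, fun j hj => by
        rwa [Nat.le_zero.1 hj]⟩
    · rw [subdivPath_last] at hiT
      exact Or.inr ⟨⟨_, hiT, subdivPath_last e⟩, fun j hj hj' => by
        rwa [le_antisymm hj' hj]⟩
    · rw [subdivPath_inner] at hiT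
      exact hiT
  have hPT : ∀ e, ∀ i ≤ k e + 1, P e i → G.subdivPath k e i ∉ Sum.inl '' Y →
      G.subdivPath k e i ∈ T := by
    intro e i hi hPi hY
    rcases eq_zero_or_last_or_inner hi with rfl | rfl | ⟨l, rfl⟩
    · rw [subdivPath_zero] at hY ⊢
      have hY' : (Quot.out (e : Sym2 V)).1 ∉ Y := fun h => hY ⟨_, h, rfl⟩
      rcases hPi with ⟨⟨w, hw, h⟩, -⟩ | ⟨⟨w, hw, h⟩, hS⟩
      · rw [subdivPath_zero, Sum.inl.injEq] at h
        exact h ▸ hw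
      · exact hZ w hw _ hY' ⟨e, fun j hj => hS j (Nat.zero_le _) hj,
          Or.inr ⟨subdivPath_zero e, h⟩⟩
    · rw [subdivPath_last] at hY ⊢
      have hY' : (Quot.out (e : Sym2 V)).2 ∉ Y := fun h => hY ⟨_, h, rfl⟩
      rcases hPi with ⟨⟨w, hw, h⟩, hS⟩ | ⟨⟨w, hw, h⟩, -⟩
      · exact hZ w hw _ hY' ⟨e, hS, Or.inl ⟨h, subdivPath_last e⟩⟩
      · rw [subdivPath_last, Sum.inl.injEq] at h
        exact h ▸ hw
    · rw [subdivPath_inner]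
      exact hPi
  have hBT : B ⊆ T := by
    refine hB.subset_of_closed T ?_ ⟨Sum.inl u, huB, huZ⟩
    rintro x hx hxS y hyS ⟨e, i, hi, h⟩
    rcases Sym2.eq_iff.1 h with ⟨rfl, rfl⟩ | ⟨rfl, rfl⟩
    · refine hPT e _ (by omega) ?_ hyS.2
      rcases hTP e i (by omega) hx hxS.1 with ⟨h1, h2⟩ | ⟨h1, h2⟩
      · refine Or.inl ⟨h1, fun j hj => ?_⟩
        rcases hj.lt_or_eq with hj | rfl
        exacts [h2 j (by omega), hyS.1]
      · exact Or.inr ⟨h1, fun j hj => h2 j (by omega)⟩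
    · refine hPT e _ (by omega) ?_ hyS.2
      rcases hTP e (i + 1) (by omega) hx hxS.1 with ⟨h1, h2⟩ | ⟨h1, h2⟩
      · exact Or.inl ⟨h1, fun j hj => h2 j (by omega)⟩
      · refine Or.inr ⟨h1, fun j hj hj' => ?_⟩
        rcases hj.lt_or_eq with hj | rfl
        exacts [h2 j (by omega) hj', hyS.1]
  exact hBT hv

/-! ### The haven of a subdivision without balanced separators -/

/-- If the subgraph induced by `S` has no balanced separator of order at most `K + 1`, then the big
components define a haven of order `K` on the branch vertices. The additional vertex is the centroid
of a big component without branch vertices with full edges. -/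
theorem exists_isHaven [Finite V] [DecidableEq V] {K : ℕ}
    (h : K + 1 < ((G.subdivide k).induce S).sepNumber) {U : Finset V}
    (hU : ∀ u, u ∈ U ↔ ∃ v, FullAdj S u v) :
    ∃ β, IsHaven (FullAdj S) U K β := by
  classical
  have hcard : ∀ Y : Finset V, (Sum.inl '' (Y : Set V) : Set (G.SubdivVertex k)).ncard = Y.card :=
    fun Y => by rw [Set.ncard_image_of_injective _ Sum.inl_injective, Set.ncard_coe_finset]
  have hex : ∀ Y : Finset V, Y.card ≤ K →
      ∃ B, IsBigPart (G.subdivide k) S (Sum.inl '' (Y : Set V)) B :=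
    fun Y hY => exists_isBigPart (by rw [hcard]; omega)
  choose! B hB using hex
  have hsub : ∀ Y : Finset V, Y.card ≤ K → ∀ v, Sum.inl v ∈ B Y → v ∉ Y :=
    fun Y hY v hv hvY => ((hB Y hY).subset hv).2 ⟨v, hvY, rfl⟩
  refine ⟨fun Y => {u ∈ U | Sum.inl u ∈ B Y}, ⟨?_, ?_, ?_, ?_, ?_⟩⟩
  · intro Y _ hYK
    by_contra hne
    rw [Finset.not_nonempty_iff_eq_empty, Finset.filter_eq_empty_iff] at hne
    obtain ⟨z, -, hz⟩ := (hB Y hYK).exists_forall_not_isBigPart_insert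
      fun z hz z' hz' hadj => exists_isCutBy ((hB Y hYK).subset.trans Set.sdiff_subset)
        (fun u v huv => hne ((hU u).2 ⟨v, huv⟩)) hz hz' hadj
    have hlt : (insert z (Sum.inl '' (Y : Set V))).ncard <
        ((G.subdivide k).induce S).sepNumber :=
      (Set.ncard_insert_le _ _).trans_lt (by rw [hcard]; omega)
    obtain ⟨C, hC⟩ := exists_isBigPart hlt
    exact hz C hC
  · intro Y _ hYK v hv
    obtain ⟨hvU, hvB⟩ := Finset.mem_filter.1 hv
    exact Finset.mem_sdiff.2 ⟨hvU, hsub Y hYK v hvB⟩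
  · intro Y _ hYK u hu v hv hvY huv
    exact Finset.mem_filter.2 ⟨hv, (hB Y hYK).mem_of_fullAdj huv (Finset.mem_filter.1 hu).2
      (by simpa using hvY)⟩
  · rintro Y - hYK Z - hZ ⟨u, hu⟩ v hv
    obtain ⟨huB, huZ⟩ := Finset.mem_inter.1 hu
    refine (hB Y hYK).inl_mem_of_closed (Z := (Z : Set V)) (fun u hu v hvY huv => ?_) huZ
      (Finset.mem_filter.1 huB).2 (Finset.mem_filter.1 hv).2
    refine hZ u hu v ((hU v).2 ⟨u, ?_⟩) (by simpa using hvY) huv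
    obtain ⟨e, he, h⟩ := huv
    exact ⟨e, he, h.symm⟩
  · intro X _ hXK Y hYU hYK hdis v hv
    obtain ⟨hvU, hvB⟩ := Finset.mem_filter.1 hv
    refine Finset.mem_filter.2 ⟨hvU, (hB X hXK).subset_of_disjoint (hB Y hYK) ?_ hvB⟩
    rw [Set.disjoint_left]
    rintro _ hx ⟨y, hy, rfl⟩
    exact Finset.disjoint_left.1 hdis (Finset.mem_filter.2 ⟨hYU hy, hx⟩) hy

/-- A set of branch vertices with full edges has at most two elements for each full edge, and the
full edges have disjoint sets of new vertices in `S`. -/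
theorem card_mul_le_two_mul_ncard [Finite V] {U : Finset V} (hU : ∀ u ∈ U, ∃ v, FullAdj S u v)
    {t : ℝ} (ht : 0 ≤ t) (hk : ∀ e, t ≤ k e) : (U.card : ℝ) * t ≤ 2 * S.ncard := by
  classical
  have := Fintype.ofFinite G.edgeSet
  set E : Finset G.edgeSet := {e | IsFullEdge S e} with hE
  have h1 : U.card ≤ 2 * E.card := by
    have hsub : U ⊆ (E.image fun e : G.edgeSet => (Quot.out (e : Sym2 V)).1) ∪
        E.image fun e : G.edgeSet => (Quot.out (e : Sym2 V)).2 := by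
      intro u hu
      obtain ⟨v, e, he, h⟩ := hU u hu
      have heE : e ∈ E := by simpa [hE] using he
      rw [subdivPath_zero, subdivPath_last] at h
      simp only [Sum.inl.injEq] at h
      rcases h with ⟨rfl, -⟩ | ⟨-, rfl⟩
      · exact Finset.mem_union_left _ (Finset.mem_image_of_mem _ heE)
      · exact Finset.mem_union_right _ (Finset.mem_image_of_mem _ heE)
    have h2 := (Finset.card_le_card hsub).trans (Finset.card_union_le _ _)
    have h3 := Finset.card_image_le (s := E) (f := fun e : G.edgeSet => (Quot.out (e : Sym2 V)).1)
    have h4 := Finset.card_image_le (s := E) (f := fun e : G.edgeSet => (Quot.out (e : Sym2 V)).2)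
    omega
  have h2 : ∑ e ∈ E, k e ≤ S.ncard := by
    have hcard : (E.sigma fun e => (Finset.univ : Finset (Fin (k e)))).card = ∑ e ∈ E, k e := by
      simp
    rw [← hcard, ← Set.ncard_coe_finset, ← Set.ncard_image_of_injective
      (f := (Sum.inr : _ → G.SubdivVertex k)) _ Sum.inr_injective]
    refine Set.ncard_le_ncard ?_ (Set.toFinite _)
    rintro _ ⟨⟨e, j⟩, hj, rfl⟩
    have he : IsFullEdge S e := by simpa [hE] using hj
    rw [← subdivPath_inner]
    exact he _ (by omega)
  have h3 : (E.card : ℝ) * t ≤ S.ncard := by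
    calc (E.card : ℝ) * t = ∑ e ∈ E, t := by simp
      _ ≤ ∑ e ∈ E, (k e : ℝ) := Finset.sum_le_sum fun e _ => hk e
      _ ≤ S.ncard := by exact_mod_cast h2
  have h4 : (U.card : ℝ) ≤ 2 * E.card := by exact_mod_cast h1
  nlinarith

end Subdivision

end SimpleGraph

/-! ### Separators of subdivided graphs -/

theorem mainTheorem6 {V : Type*} [Finite V] (G : SimpleGraph V)
    (f t p : ℝ → ℝ)
    (hf_nonneg : ∀ x : ℝ, 0 < x → 0 ≤ f x) (hf_mono : MonotoneOn f (Set.Ioi 0))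
    (ht_pos : ∀ x : ℝ, 0 < x → 0 < t x) (ht_mono : MonotoneOn t (Set.Ioi 0))
    (hp_pos : ∀ y : ℝ, 0 < y → 0 < p y) (hp_mono : MonotoneOn p (Set.Ioi 0))
    (hp_inv : ∀ x : ℝ, 0 < x → p (x * t x) = x)
    (hG : ∀ S : Set V, S.Nonempty → ((G.induce S).sepNumber : ℝ) ≤ f (S.ncard : ℝ))
    (k : G.edgeSet → ℕ) (hk : ∀ e : G.edgeSet, t (Nat.card V : ℝ) ≤ (k e : ℝ)) :
    ∀ S' : Set (G.SubdivVertex k), S'.Nonempty →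
      (((G.subdivide k).induce S').sepNumber : ℝ) ≤ 15 * f (p (2 * (S'.ncard : ℝ))) + 1 := by
  classical
  intro S' hS'
  by_contra! hlt
  have := Fintype.ofFinite V
  have hN : (0 : ℝ) < 2 * (S'.ncard : ℝ) := by
    have := (Set.ncard_pos (Set.toFinite S')).2 hS'
    positivity
  have hp0 := hp_pos _ hN
  have hf0 := hf_nonneg _ hp0
  set a := ⌊f (p (2 * (S'.ncard : ℝ)))⌋₊ with ha
  have haf : (a : ℝ) ≤ f (p (2 * (S'.ncard : ℝ))) := Nat.floor_le hf0
  have hsep : 13 * a + 1 < ((G.subdivide k).induce S').sepNumber := by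
    have : ((13 * a + 1 : ℕ) : ℝ) < (((G.subdivide k).induce S').sepNumber : ℝ) := by
      push_cast
      linarith
    exact_mod_cast this
  set U : Finset V := {u | ∃ v, SimpleGraph.FullAdj S' u v} with hUdef
  have hU : ∀ u, u ∈ U ↔ ∃ v, SimpleGraph.FullAdj S' u v := fun u => by simp [hUdef]
  obtain ⟨β, hβ⟩ := SimpleGraph.exists_isHaven hsep hU
  -- It remains to bound the separation numbers of the subgraphs of `G` induced by subsets of `U`.
  refine hβ.false_of_hasBalancedSeparators
    (SimpleGraph.hasBalancedSeparators_of_sepNumber_le (G := G) (fun u v h => h.adj)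
      fun F hFU hF => ?_)
  have hFpos : (0 : ℝ) < F.card := by exact_mod_cast hF.card_pos
  have hFle : (F.card : ℝ) ≤ Nat.card V := by
    rw [Nat.card_eq_fintype_card]
    exact_mod_cast F.card_le_univ
  have hVpos : (0 : ℝ) < Nat.card V := hFpos.trans_le hFle
  have hFt : (F.card : ℝ) * t F.card ≤ 2 * S'.ncard :=
    (mul_le_mul_of_nonneg_left (ht_mono hFpos hVpos hFle) hFpos.le).trans
      (SimpleGraph.card_mul_le_two_mul_ncard (fun u hu => (hU u).1 (hFU hu))
        (ht_pos _ hVpos).le hk)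
  have hFp : (F.card : ℝ) ≤ p (2 * S'.ncard) := by
    have := hp_mono (mul_pos hFpos (ht_pos _ hFpos)) hN hFt
    rwa [hp_inv _ hFpos] at this
  have h1 := hG (F : Set V) (by simpa using hF)
  rw [Set.ncard_coe_finset] at h1
  exact Nat.le_floor (h1.trans (hf_mono hFpos hp0 hFp))
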